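/- Let $\mathbb K$ be a field of characteristic $0$, let $n\ge 1$, and let $\mathcal A=\{\ell_1,\dots,\ell_n\}$ be nonzero linear forms in $R=\mathbb K[x_1,\dots,x_k]$, no two of which are proportional (i.e. $\gcd(\ell_i,\ell_j)=1$ for $i\neq j$). Let $OT(2,\mathcal A)=\mathbb K\left[\frac{1}{\ell_i\ell_j} : 1\le i<j\le n\right]$, a subalgebra of the field of fractions of $R$. Put $\mathbf S=\mathbb K[y_1,\dots,y_n]$ and $\mathbf T=\mathbb K[t_{i,j} : 1\le i<j\le n]$, and let $I(\mathcal A)\subseteq\mathbf S$ be the kernel of $y_i\mapsto \frac1{\ell_i}$ and $I(2,\mathcal A)\subseteq\mathbf T$ the kernel of $t_{i,j}\mapsto\frac1{\ell_i\ell_j}$. (For $n\ge 3$, $I(2,\mathcal A)$ is also the kernel of $t_{i,j}\mapsto f_{i,j}=\frac{\ell_1\cdots\ell_n}{\ell_i\ell_j}$.) Let $J(\mathcal A)$ be the ideal of $\mathbf S$ generated by all $F(\dots,y_iy_j,\dots)$ with $F\in I(2,\mathcal A)$, let $\mathbf S'=\mathbb K[y_iy_j : 1\le i<j\le n]\subseteq\mathbf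 S$, and let $J'(\mathcal A)=J(\mathcal A)\cap\mathbf S'$. Then: 1. $J(\mathcal A):\langle y_1,\dots,y_n\rangle=I(\mathcal A)$ in $\mathbf S$. 2. $J'(\mathcal A)=I(\mathcal A)\cap\mathbf S'$. 3. There is an isomorphism of $\mathbb K$-algebras $OT(2,\mathcal A)\cong\mathbf S'/J'(\mathcal A)$ that sends $\frac1{\ell_i\ell_j}$ to the class of $y_iy_j$ for all $1\le i<j\le n$. -/

import Mathlib

open MvPolynomial

namespace OrlikTerao

noncomputable section

/-- The forms `ℓ₁, …, ℓₙ ∈ R = K[x₁, …, x_k]` define a central hyperplane arrangement with `n`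
distinct hyperplanes: they are nonzero linear forms with `gcd (ℓᵢ, ℓⱼ) = 1` for `i ≠ j`
(equivalently, no two of them are proportional). -/
structure IsArrangement {K : Type*} [Field K] {k n : ℕ}
    (ℓ : Fin n → MvPolynomial (Fin k) K) : Prop where
  isHomogeneous : ∀ i, (ℓ i).IsHomogeneous 1
  ne_zero : ∀ i, ℓ i ≠ 0
  isRelPrime : ∀ i j, i ≠ j → IsRelPrime (ℓ i) (ℓ j)

/-- The set of index pairs `(i, j)` with `i < j`. -/
abbrev Pairs (n : ℕ) : Type := {p : Fin n × Fin n // p.1 < p.2}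

section Definitions

variable {K : Type*} [Field K] {k n : ℕ} (ℓ : Fin n → MvPolynomial (Fin k) K)

/-- The reciprocal `1 / ℓᵢ` in the field of fractions of `R`. -/
def recip (i : Fin n) : FractionRing (MvPolynomial (Fin k) K) :=
  (algebraMap (MvPolynomial (Fin k) K) (FractionRing (MvPolynomial (Fin k) K)) (ℓ i))⁻¹

/-- The reciprocal `1 / (ℓᵢ ℓⱼ)` in the field of fractions of `R`. -/
def recip₂ (p : Pairs n) : FractionRing (MvPolynomial (Fin k) K) :=
  (algebraMap (MvPolynomial (Fin k) K) (FractionRing (MvPolynomial (Fin k) K))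
    (ℓ p.1.1 * ℓ p.1.2))⁻¹

/-- The Orlik-Terao algebra of the second order `OT(2, 𝒜) = K[…, 1/(ℓᵢ ℓⱼ), …]`, `i < j`. -/
def OT₂ : Subalgebra K (FractionRing (MvPolynomial (Fin k) K)) :=
  Algebra.adjoin K (Set.range (recip₂ ℓ))

/-- The generator `1 / (ℓᵢ ℓⱼ)` as an element of `OT(2, 𝒜)`. -/
def OT₂.gen (p : Pairs n) : OT₂ ℓ :=
  ⟨recip₂ ℓ p, Algebra.subset_adjoin (Set.mem_range_self p)⟩

/-- The defining ideal `I(𝒜) ⊆ S = K[y₁, …, yₙ]` of the Orlik-Terao algebra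
`K[1/ℓ₁, …, 1/ℓₙ]`: the kernel of `yᵢ ↦ 1/ℓᵢ`. -/
def presIdeal : Ideal (MvPolynomial (Fin n) K) :=
  RingHom.ker (aeval (R := K) (recip ℓ))

/-- The defining ideal `I(2, 𝒜) ⊆ T = K[…, t_{i,j}, …]` of `OT(2, 𝒜)`: the kernel of
`t_{i,j} ↦ 1/(ℓᵢ ℓⱼ)`. For `n ≥ 3` it is also the kernel of `t_{i,j} ↦ f_{i,j}`,
where `f_{i,j} = ℓ₁ ⋯ ℓₙ / (ℓᵢ ℓⱼ)`; see `mem_presIdeal₂_iff`. -/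
def presIdeal₂ : Ideal (MvPolynomial (Pairs n) K) :=
  RingHom.ker (aeval (R := K) (recip₂ ℓ))

variable (K n) in
/-- The substitution `T → S`, `t_{i,j} ↦ yᵢ yⱼ`. -/
def subst : MvPolynomial (Pairs n) K →ₐ[K] MvPolynomial (Fin n) K :=
  aeval fun p => X p.1.1 * X p.1.2

/-- The ideal `J(𝒜)` of `S` generated by all `F(…, yᵢ yⱼ, …)` with `F ∈ I(2, 𝒜)`. -/
def idealJ : Ideal (MvPolynomial (Fin n) K) :=
  Ideal.span {G | ∃ F ∈ presIdeal₂ ℓ, G = subst K n F}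

variable (K n) in
/-- The subring `S' = K[…, yᵢ yⱼ, …]` of `S`, with `i < j`. -/
def subringS' : Subalgebra K (MvPolynomial (Fin n) K) :=
  Algebra.adjoin K (Set.range fun p : Pairs n => X p.1.1 * X p.1.2)

variable (K) in
/-- The generator `yᵢ yⱼ` as an element of `S'`. -/
def subringS'.gen (p : Pairs n) : subringS' K n :=
  ⟨X p.1.1 * X p.1.2, Algebra.subset_adjoin (Set.mem_range_self p)⟩

/-- The intersection `I ∩ S'` of an ideal `I` of `S` with `S'`, as an ideal of `S'`. -/
def interS' (I : Ideal (MvPolynomial (Fin n) K)) : Ideal (subringS' K n) :=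
  I.comap (subringS' K n).val

/-- The ideal `J'(𝒜) = J(𝒜) ∩ S'` of `S'`. -/
def idealJ' : Ideal (subringS' K n) := interS' (idealJ ℓ)

/-- The product `f_{i,j} = ℓ₁ ⋯ ℓₙ / (ℓᵢ ℓⱼ) ∈ R` of all forms except `ℓᵢ` and `ℓⱼ`. -/
def coprod (p : Pairs n) : MvPolynomial (Fin k) K :=
  ∏ u ∈ Finset.univ \ {p.1.1, p.1.2}, ℓ u

end Definitions

section Check

variable {K : Type*} [Field K] {k n : ℕ} {ℓ : Fin n → MvPolynomial (Fin k) K}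

theorem eq_zero_of_sum_homogeneous {N : ℕ} {P : ℕ → MvPolynomial (Fin k) K} {e : ℕ → ℕ}
    (hP : ∀ d ∈ Finset.range N, (P d).IsHomogeneous (e d))
    (he : Set.InjOn e (Finset.range N : Set ℕ))
    (h : ∑ d ∈ Finset.range N, P d = 0) : ∀ d ∈ Finset.range N, P d = 0 := by
  intro d hd
  have h1 := congrArg (homogeneousComponent (e d)) h
  rw [map_sum, map_zero, Finset.sum_eq_single d] at h1
  · simpa [homogeneousComponent_of_mem (hP d hd)] using h1
  · intro b hb hbd
    rw [homogeneousComponent_of_mem (hP b hb), if_neg]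
    exact fun h2 => hbd (he hb hd h2.symm)
  · exact fun h2 => absurd hd h2

theorem prod_eq_mul_coprod (p : Pairs n) :
    ∏ u, ℓ u = coprod ℓ p * (ℓ p.1.1 * ℓ p.1.2) := by
  rw [coprod, ← Finset.prod_pair p.2.ne, Finset.prod_sdiff (Finset.subset_univ _)]

theorem coprod_isHomogeneous (hℓ : IsArrangement ℓ) (p : Pairs n) :
    (coprod ℓ p).IsHomogeneous (n - 2) := by
  have h := IsHomogeneous.prod (Finset.univ \ {p.1.1, p.1.2}) ℓ (fun _ => 1)
    (fun i _ => hℓ.isHomogeneous i)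
  have hc : (Finset.univ \ {p.1.1, p.1.2} : Finset (Fin n)).card = n - 2 := by
    rw [Finset.card_sdiff_of_subset (Finset.subset_univ _), Finset.card_pair p.2.ne]
    simp
  simpa [hc, coprod] using h

theorem algebraMap_aeval_coprod (hℓ : IsArrangement ℓ) {d : ℕ}
    {F : MvPolynomial (Pairs n) K} (hF : F.IsHomogeneous d) :
    algebraMap _ (FractionRing (MvPolynomial (Fin k) K)) (aeval (coprod ℓ) F) =
      (algebraMap _ (FractionRing (MvPolynomial (Fin k) K)) (∏ u, ℓ u)) ^ d *
        aeval (recip₂ ℓ) F := by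
  have hg : ∀ p : Pairs n, algebraMap _ (FractionRing (MvPolynomial (Fin k) K)) (coprod ℓ p) =
      algebraMap _ (FractionRing (MvPolynomial (Fin k) K)) (∏ u, ℓ u) * recip₂ ℓ p := by
    intro p
    have h0 : algebraMap _ (FractionRing (MvPolynomial (Fin k) K)) (ℓ p.1.1 * ℓ p.1.2) ≠ 0 := by
      rw [Ne, FaithfulSMul.algebraMap_eq_zero_iff]
      exact mul_ne_zero (hℓ.ne_zero _) (hℓ.ne_zero _)
    rw [prod_eq_mul_coprod p, map_mul, recip₂, mul_assoc, mul_inv_cancel₀ h0, mul_one]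
  rw [← aeval_algebraMap_apply, aeval_def, aeval_def, eval₂_eq, eval₂_eq, Finset.mul_sum]
  refine Finset.sum_congr rfl fun m hm => ?_
  have hd : ∑ i ∈ m.support, m i = d := by
    have := hF (mem_support_iff.1 hm)
    simpa [Finsupp.weight_apply, Finsupp.sum] using this
  simp only [Function.comp_apply, hg, mul_pow, Finset.prod_mul_distrib, Finset.prod_pow_eq_pow_sum, hd]
  ring

/-- For `n ≥ 3`, `I(2, 𝒜) = {F ∈ T | F(…, f_{i,j}, …) = 0}`. (For `n = 2` the only `f_{i,j}` is the
constant `1`, and only homogeneous `F` are detected in this way.) -/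
theorem mem_presIdeal₂_iff (hℓ : IsArrangement ℓ) (hn : 3 ≤ n) (F : MvPolynomial (Pairs n) K) :
    F ∈ presIdeal₂ ℓ ↔ aeval (coprod ℓ) F = 0 := by
  have hf : (∏ u, ℓ u) ≠ 0 := Finset.prod_ne_zero_iff.2 fun i _ => hℓ.ne_zero i
  have hfh : (∏ u, ℓ u).IsHomogeneous n := by
    simpa using IsHomogeneous.prod Finset.univ ℓ (fun _ => 1) (fun i _ => hℓ.isHomogeneous i)
  have hc : algebraMap _ (FractionRing (MvPolynomial (Fin k) K)) (∏ u, ℓ u) ≠ 0 := by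
    rwa [Ne, FaithfulSMul.algebraMap_eq_zero_iff]
  have hhom : ∀ d, (aeval (coprod ℓ) (homogeneousComponent d F)).IsHomogeneous ((n - 2) * d) :=
    fun d => (homogeneousComponent_isHomogeneous d F).aeval _ (coprod_isHomogeneous hℓ)
  have hkey := fun d => algebraMap_aeval_coprod hℓ (homogeneousComponent_isHomogeneous d F)
  rw [presIdeal₂, RingHom.mem_ker]
  constructor
  · intro h
    have h1 : ∑ d ∈ Finset.range (F.totalDegree + 1), (∏ u, ℓ u) ^ (F.totalDegree - d) *
        aeval (coprod ℓ) (homogeneousComponent d F) = 0 := by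
      apply FaithfulSMul.algebraMap_injective _ (FractionRing (MvPolynomial (Fin k) K))
      rw [map_sum, map_zero, ← mul_zero
        (algebraMap _ (FractionRing (MvPolynomial (Fin k) K)) (∏ u, ℓ u) ^ F.totalDegree), ← h]
      have hs : aeval (recip₂ ℓ) F = ∑ d ∈ Finset.range (F.totalDegree + 1),
          aeval (recip₂ ℓ) (homogeneousComponent d F) := by
        rw [← map_sum, sum_homogeneousComponent]
      rw [hs, Finset.mul_sum]
      refine Finset.sum_congr rfl fun d hd => ?_
      rw [map_mul, map_pow, hkey, ← mul_assoc, ← pow_add,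
        Nat.sub_add_cancel (Nat.lt_succ_iff.1 (Finset.mem_range.1 hd))]
    have h2 := eq_zero_of_sum_homogeneous
      (e := fun d => n * (F.totalDegree - d) + (n - 2) * d)
      (fun d _ => (hfh.pow _).mul (hhom d)) ?_ h1
    · rw [← sum_homogeneousComponent F, map_sum]
      refine Finset.sum_eq_zero fun d hd => ?_
      exact (mul_eq_zero.1 (h2 d hd)).resolve_left (pow_ne_zero _ hf)
    · have hE : ∀ d ≤ F.totalDegree,
          n * (F.totalDegree - d) + (n - 2) * d + 2 * d = n * F.totalDegree := by
        intro d hd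
        obtain ⟨c, hc'⟩ := Nat.exists_eq_add_of_le hd
        obtain ⟨m, rfl⟩ := Nat.exists_eq_add_of_le hn
        rw [hc', Nat.add_sub_cancel_left, show 3 + m - 2 = 1 + m by omega]
        ring
      intro a ha b hb hab
      have ha' := hE a (Nat.lt_succ_iff.1 (Finset.mem_range.1 ha))
      have hb' := hE b (Nat.lt_succ_iff.1 (Finset.mem_range.1 hb))
      simp only at hab
      omega
  · intro h
    rw [← sum_homogeneousComponent F, map_sum] at h
    have h2 := eq_zero_of_sum_homogeneous (fun d _ => hhom d) ?_ h
    · rw [← sum_homogeneousComponent F, map_sum]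
      refine Finset.sum_eq_zero fun d hd => ?_
      have h3 := hkey d
      rw [h2 d hd, map_zero] at h3
      exact (mul_eq_zero.1 h3.symm).resolve_left (pow_ne_zero _ hc)
    · intro a _ b _ hab
      exact Nat.eq_of_mul_eq_mul_left (by omega) hab

end Check

end

end OrlikTerao

/-! Substituting `yᵢyⱼ` and then evaluating at `1/ℓᵢ` is evaluating at `1/(ℓᵢℓⱼ)`. So `J ⊆ I`, and
an element of `I ∩ S'` is `F(…, yᵢyⱼ, …)` with `F ∈ I(2, 𝒜)`: this is claim 2, and claim 3 follows
by the first isomorphism theorem.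

For claim 1, `J : ⟨y⟩ ⊆ I` because `1/ℓᵢ` is a nonzero element of a field. Conversely, `I` is
generated by the polynomials `depPoly a T` of linear dependencies (`presIdeal_eq_depIdeal`),
homogeneous of degree `|T| - 1`. If `|T|` is odd, such a polynomial already lies in `S'`; if `|T| ≥
4` is even, its product with any `yᵢ` does (`X_mul_depPoly_mem_idealJ`). Dependencies with `|T| ≤ 2`
are trivial in an arrangement.

Generation is by induction on `n`, lowering the degree in `y₀`: the top coefficient is a relation
among the reciprocals of the forms modulo `ℓ₀` (`coeff_mem_presIdeal`), and dependencies modulo `ℓ₀`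
lift (`exists_X_zero_mul_sub_mem`). -/

namespace OrlikTerao

noncomputable section

/-- The polynomial `∑_{j ∈ T} aⱼ ∏_{u ∈ T ∖ j} yᵤ` attached to a family of coefficients supported
on `T`. -/
def depPoly {K : Type*} [Field K] {n : ℕ} (a : Fin n → K) (T : Finset (Fin n)) :
    MvPolynomial (Fin n) K :=
  ∑ j ∈ T, C (a j) * ∏ u ∈ T.erase j, X u

/-- The ideal generated by the polynomials attached to the linear dependencies of the forms. -/
def depIdeal {K : Type*} [Field K] {k n : ℕ} (ℓ : Fin n → MvPolynomial (Fin k) K) :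
    Ideal (MvPolynomial (Fin n) K) :=
  Ideal.span {G | ∃ (a : Fin n → K) (T : Finset (Fin n)),
    ∑ j ∈ T, C (a j) * ℓ j = 0 ∧ G = depPoly a T}

/-! ### Linear dependencies generate the relations among the reciprocals. -/

section Generation

variable {K : Type*} [Field K] {k n : ℕ}

theorem depPoly_mem_depIdeal {ℓ : Fin n → MvPolynomial (Fin k) K} {a : Fin n → K}
    {T : Finset (Fin n)} (h : ∑ j ∈ T, C (a j) * ℓ j = 0) : depPoly a T ∈ depIdeal ℓ :=
  Ideal.subset_span ⟨a, T, h, rfl⟩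

theorem algebraMap_form_ne_zero {ℓ : Fin n → MvPolynomial (Fin k) K} (h0 : ∀ i, ℓ i ≠ 0)
    (i : Fin n) :
    algebraMap (MvPolynomial (Fin k) K) (FractionRing (MvPolynomial (Fin k) K)) (ℓ i) ≠ 0 := by
  rw [Ne, FaithfulSMul.algebraMap_eq_zero_iff]
  exact h0 i

/-- At `yᵤ = 1/ℓᵤ`, `depPoly a T` becomes the dependency divided by `∏ u ∈ T, ℓ u`. -/
theorem depIdeal_le_presIdeal {ℓ : Fin n → MvPolynomial (Fin k) K} (h0 : ∀ i, ℓ i ≠ 0) :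
    depIdeal ℓ ≤ presIdeal ℓ := by
  rw [depIdeal, Ideal.span_le]
  rintro _ ⟨a, T, h, rfl⟩
  rw [SetLike.mem_coe, presIdeal, RingHom.mem_ker]
  have h1 := congrArg
    (algebraMap (MvPolynomial (Fin k) K) (FractionRing (MvPolynomial (Fin k) K))) h
  rw [map_sum, map_zero] at h1
  rw [depPoly, map_sum, ← mul_zero (∏ u ∈ T, recip ℓ u), ← h1, Finset.mul_sum]
  refine Finset.sum_congr rfl fun j hj => ?_
  rw [← Finset.mul_prod_erase T _ hj]
  simp only [map_mul, map_prod, aeval_X, aeval_C]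
  have h2 := algebraMap_form_ne_zero h0 j
  rw [IsScalarTower.algebraMap_apply K (MvPolynomial (Fin k) K), MvPolynomial.algebraMap_eq]
  have h3 : recip ℓ j = (algebraMap (MvPolynomial (Fin k) K) _ (ℓ j))⁻¹ := rfl
  rw [h3]
  field_simp

theorem depPoly_map_succ (b : K) (a : Fin n → K) (T : Finset (Fin n)) :
    depPoly (Fin.cons b a) (T.map (Fin.succEmb n)) = rename Fin.succ (depPoly a T) := by
  simp only [depPoly, Finset.sum_map, map_sum, map_mul, map_prod, rename_C, rename_X,
    Fin.coe_succEmb, Fin.cons_succ]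
  refine Finset.sum_congr rfl fun j _ => ?_
  rw [← Fin.coe_succEmb, ← Finset.map_erase, Finset.prod_map]

/-- The term of index `0` is the only one that omits `y₀`. -/
theorem depPoly_insert_zero (b : K) (a : Fin n → K) (T : Finset (Fin n)) :
    depPoly (Fin.cons b a) (insert 0 (T.map (Fin.succEmb n))) =
      C b * rename Fin.succ (∏ u ∈ T, X u) + X 0 * rename Fin.succ (depPoly a T) := by
  have h0 : ∀ U : Finset (Fin n), (0 : Fin (n + 1)) ∉ U.map (Fin.succEmb n) := by
    intro U; simp
  rw [← depPoly_map_succ b a T, depPoly, Finset.sum_insert (h0 T), Finset.erase_insert (h0 T)]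
  simp only [Fin.cons_zero, Finset.prod_map, map_prod, rename_X, Fin.coe_succEmb, depPoly,
    Finset.mul_sum, Finset.sum_map, Fin.cons_succ]
  congr 1
  refine Finset.sum_congr rfl fun j _ => ?_
  rw [Finset.erase_insert_of_ne (Fin.succ_ne_zero j).symm, Finset.prod_insert]
  · ring
  · exact fun h => h0 T (Finset.mem_of_mem_erase h)

theorem rename_succ_mem_depIdeal {ℓ : Fin (n + 1) → MvPolynomial (Fin k) K}
    {G : MvPolynomial (Fin n) K} (hG : G ∈ depIdeal fun i => ℓ (Fin.succ i)) :
    rename Fin.succ G ∈ depIdeal ℓ := by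
  suffices h : depIdeal (fun i => ℓ (Fin.succ i)) ≤
      (depIdeal ℓ).comap (rename (R := K) (Fin.succ (n := n))) from h hG
  rw [depIdeal, Ideal.span_le]
  rintro _ ⟨a, T, h, rfl⟩
  rw [SetLike.mem_coe, Ideal.mem_comap, ← depPoly_map_succ 0]
  apply depPoly_mem_depIdeal
  simpa [Finset.sum_map] using h

/-- Linear dependencies modulo `ℓ₀` allow to lower the degree in `y₀`. -/
theorem exists_X_zero_mul_sub_mem {ℓ : Fin (n + 1) → MvPolynomial (Fin k) K}
    {ℓ' : Fin n → MvPolynomial (Fin k) K} {s : Fin n → K}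
    (hs : ∀ j, ℓ' j = ℓ j.succ - C (s j) * ℓ 0)
    {G : MvPolynomial (Fin n) K} (hG : G ∈ depIdeal ℓ') :
    ∃ H : MvPolynomial (Fin n) K, X 0 * rename Fin.succ G - rename Fin.succ H ∈ depIdeal ℓ := by
  rw [depIdeal] at hG
  induction hG using Submodule.span_induction with
  | mem x hx =>
    obtain ⟨a, T, h, rfl⟩ := hx
    -- The coefficient of `ℓ 0` when the dependency of the `ℓ' j` is rewritten in terms of the `ℓ
    -- j.succ`.
    set b : K := -∑ j ∈ T, a j * s j
    refine ⟨-(C b * ∏ u ∈ T, X u), ?_⟩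
    have h1 : ∑ j ∈ insert 0 (T.map (Fin.succEmb n)),
        C ((Fin.cons b a : Fin (n + 1) → K) j) * ℓ j = 0 := by
      rw [Finset.sum_insert (by simp), Finset.sum_map]
      simp only [Fin.cons_zero, Fin.coe_succEmb, Fin.cons_succ, b, map_neg, map_sum, map_mul]
      rw [← h, neg_mul, Finset.sum_mul, ← Finset.sum_neg_distrib, ← Finset.sum_add_distrib]
      refine Finset.sum_congr rfl fun j _ => ?_
      rw [hs]; ring
    convert depPoly_mem_depIdeal h1 using 1
    rw [depPoly_insert_zero, map_neg, map_mul, rename_C]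
    ring
  | zero => exact ⟨0, by simp⟩
  | add x y _ _ hx hy =>
    obtain ⟨H₁, h₁⟩ := hx
    obtain ⟨H₂, h₂⟩ := hy
    refine ⟨H₁ + H₂, ?_⟩
    convert add_mem h₁ h₂ using 1
    simp only [map_add]
    ring
  | smul c x _ hx =>
    obtain ⟨H, h⟩ := hx
    refine ⟨c * H, ?_⟩
    convert Ideal.mul_mem_left _ (rename Fin.succ c) h using 1
    simp only [map_mul, smul_eq_mul]
    ring

/-- A nonzero linear form `v` is killed by an endomorphism of the polynomial ring that changes
linear forms by multiples of `v` only. -/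
theorem exists_projection {v : MvPolynomial (Fin k) K} (hv : v.IsHomogeneous 1) (h0 : v ≠ 0) :
    ∃ φ : MvPolynomial (Fin k) K →ₐ[K] MvPolynomial (Fin k) K, φ v = 0 ∧
      ∀ w : MvPolynomial (Fin k) K, w.IsHomogeneous 1 → ∃ c : K, φ w = w - C c * v := by
  obtain ⟨m, hm⟩ := ne_zero_iff.1 h0
  -- A linear functional normalized so that `f v = 1`; then `w ↦ w - f(w) v` kills `v`.
  set f : MvPolynomial (Fin k) K →ₗ[K] K := (coeff m v)⁻¹ • lcoeff K m
  set φ : MvPolynomial (Fin k) K →ₐ[K] MvPolynomial (Fin k) K :=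
    aeval fun i => X i - C (f (X i)) * v
  have hφ : ∀ w : MvPolynomial (Fin k) K, w.IsHomogeneous 1 → φ w = w - C (f w) * v := by
    intro w hw
    rw [← mem_homogeneousSubmodule, homogeneousSubmodule_one_eq_span_X] at hw
    induction hw using Submodule.span_induction with
    | mem x hx =>
      obtain ⟨i, rfl⟩ := hx
      simp [φ]
    | zero => simp
    | add x y _ _ hx hy => rw [map_add, map_add, hx, hy, map_add]; ring
    | smul c x _ hx =>
      rw [map_smul, map_smul, hx, smul_eq_C_mul, smul_eq_mul, map_mul, smul_eq_C_mul]; ring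
  refine ⟨φ, ?_, fun w hw => ⟨f w, hφ w hw⟩⟩
  have : f v = 1 := by
    simp [f, inv_mul_cancel₀ hm]
  rw [hφ v hv, this, C_1, one_mul, sub_self]

/-- Specialization of rational functions without pole along the kernel of `φ`: if a polynomial in
`1/v` with coefficients evaluated at `1/ℓⱼ` vanishes and `φ v = 0`, `φ ℓⱼ ≠ 0`, then the top
coefficient vanishes at `1/φ ℓⱼ`. -/
theorem coeff_mem_presIdeal {ℓ : Fin n → MvPolynomial (Fin k) K} {v : MvPolynomial (Fin k) K}
    (hv : v ≠ 0) (φ : MvPolynomial (Fin k) K →ₐ[K] MvPolynomial (Fin k) K) (hφv : φ v = 0)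
    (hφ : ∀ j, φ (ℓ j) ≠ 0) {D : ℕ} {p : Polynomial (MvPolynomial (Fin n) K)}
    (hp : p.natDegree ≤ D)
    (h : p.eval₂ (aeval (R := K) (recip ℓ) : MvPolynomial (Fin n) K →+* _)
      (algebraMap (MvPolynomial (Fin k) K) (FractionRing (MvPolynomial (Fin k) K)) v)⁻¹ = 0) :
    p.coeff D ∈ presIdeal fun j => φ (ℓ j) := by
  set F := FractionRing (MvPolynomial (Fin k) K)
  -- The complement of the prime `ker φ`: it contains every `ℓ j` but not `v`. Both the inclusion
  -- into `F` (as `ι`) and `φ` (as `ψ`) extend to the localization at `M`.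
  set M : Submonoid (MvPolynomial (Fin k) K) := (nonZeroDivisors (MvPolynomial (Fin k) K)).comap φ
  have hM : ∀ x : MvPolynomial (Fin k) K, x ∈ M ↔ φ x ≠ 0 := fun x => by simp [M]
  set ι : Localization M →ₐ[MvPolynomial (Fin k) K] F :=
    IsLocalization.liftAlgHom (M := M) (f := Algebra.ofId (MvPolynomial (Fin k) K) F) (by
      intro y
      rw [isUnit_iff_ne_zero, Algebra.ofId_apply, Ne, FaithfulSMul.algebraMap_eq_zero_iff]
      rintro hy
      exact (hM _).1 y.2 (by rw [hy, map_zero]))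
  set ψ : Localization M →ₐ[K] F :=
    IsLocalization.liftAlgHom (M := M)
      (f := ((Algebra.ofId (MvPolynomial (Fin k) K) F).restrictScalars K).comp φ) (by
      intro y
      rw [isUnit_iff_ne_zero, AlgHom.comp_apply, AlgHom.restrictScalars_apply,
        Algebra.ofId_apply, Ne, FaithfulSMul.algebraMap_eq_zero_iff]
      exact (hM _).1 y.2)
  have hψ : ∀ x, ψ (algebraMap _ _ x) = algebraMap _ F (φ x) := fun x => by
    simp [ψ, Algebra.ofId_apply]
  have hι : Function.Injective ι := by
    rw [injective_iff_map_eq_zero]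
    intro x hx
    obtain ⟨⟨r, s⟩, hrs⟩ := IsLocalization.surj M x
    have h1 := congrArg ι hrs
    rw [map_mul, hx, zero_mul, AlgHom.commutes, eq_comm,
      FaithfulSMul.algebraMap_eq_zero_iff] at h1
    rw [h1, map_zero] at hrs
    exact (IsUnit.mul_left_eq_zero (IsLocalization.map_units _ s)).1 hrs
  set u : Fin n → Localization M := fun j => IsLocalization.mk' _ 1 ⟨ℓ j, (hM _).2 (hφ j)⟩
  have hu : ∀ j, algebraMap _ _ (ℓ j) * u j = 1 := fun j => by
    rw [mul_comm]
    exact (IsLocalization.mk'_spec (Localization M) 1 ⟨ℓ j, (hM _).2 (hφ j)⟩).trans (map_one _)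
  have hιu : ∀ j, ι (u j) = recip ℓ j := fun j => by
    have := congrArg ι (hu j)
    rw [map_mul, AlgHom.commutes, map_one] at this
    exact eq_inv_of_mul_eq_one_right this
  have hψu : ∀ j, ψ (u j) = recip (fun j => φ (ℓ j)) j := fun j => by
    have := congrArg ψ (hu j)
    rw [map_mul, hψ, map_one] at this
    exact eq_inv_of_mul_eq_one_right this
  let g : MvPolynomial (Fin n) K →+* Localization M :=
    (aeval (R := K) u : MvPolynomial (Fin n) K →ₐ[K] Localization M)
  have hιg : (ι : Localization M →+* F).comp g = (aeval (R := K) (recip ℓ) : MvPolynomial (Fin n) K →ₐ[K] F) := by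
    have : (ι.restrictScalars K).comp (aeval (R := K) u) = aeval (R := K) (recip ℓ) :=
      algHom_ext fun j => by simp [hιu]
    exact congrArg (fun f : MvPolynomial (Fin n) K →ₐ[K] F => (f : MvPolynomial (Fin n) K →+* F)) this
  have hψg : (ψ : Localization M →+* F).comp g =
      (aeval (R := K) (recip fun j => φ (ℓ j)) : MvPolynomial (Fin n) K →ₐ[K] F) := by
    have : ψ.comp (aeval (R := K) u) = aeval (R := K) (recip fun j => φ (ℓ j)) :=
      algHom_ext fun j => by simp [hψu]
    exact congrArg (fun f : MvPolynomial (Fin n) K →ₐ[K] F => (f : MvPolynomial (Fin n) K →+* F)) this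
  have hv' : algebraMap (MvPolynomial (Fin k) K) F v ≠ 0 := by
    rwa [Ne, FaithfulSMul.algebraMap_eq_zero_iff]
  -- Reflection clears the pole: the value is `v ^ D` times that of `p` at `1/v`. The equation thus
  -- lives in the localization, where `ι` is injective.
  have h1 : (p.reflect D).eval₂ g (algebraMap _ _ v) = 0 := by
    apply hι
    have h2 := Polynomial.hom_eval₂ (p.reflect D) g (ι : Localization M →+* F) (algebraMap _ _ v)
    rw [map_zero]
    refine h2.trans ?_
    rw [hιg]
    let _ := invertibleOfNonzero (inv_ne_zero hv')
    have h3 := (Polynomial.eval₂_reflect_eq_zero_iff _ _ D p hp).2 h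
    rw [invOf_eq_inv, inv_inv] at h3
    rw [← h3]
    congr 1
    exact ι.commutes v
  -- Since `ψ` sends `v` to `0`, only the constant coefficient of the reflection survives, namely
  -- `p.coeff D`.
  have h2 := Polynomial.hom_eval₂ (p.reflect D) g (ψ : Localization M →+* F) (algebraMap _ _ v)
  rw [h1, map_zero, hψg, RingHom.coe_coe, hψ, hφv, map_zero, Polynomial.eval₂_at_zero,
    Polynomial.coeff_reflect, Polynomial.revAt_zero] at h2
  exact h2.symm

/-- If `ℓ₀` is proportional to another form, the variable `y₀` can be eliminated. -/
theorem exists_sub_rename_succ_mem {ℓ : Fin (n + 1) → MvPolynomial (Fin k) K} {j : Fin n} {c : K}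
    (hj : ℓ j.succ = C c * ℓ 0) (G : MvPolynomial (Fin (n + 1)) K) :
    ∃ H : MvPolynomial (Fin n) K, G - rename Fin.succ H ∈ depIdeal ℓ := by
  set σ : MvPolynomial (Fin (n + 1)) K →ₐ[K] MvPolynomial (Fin n) K :=
    aeval (Fin.cons (C c * X j) X)
  refine ⟨σ G, ?_⟩
  have h1 : C c * X j.succ - X 0 ∈ depIdeal ℓ := by
    -- The dependency `c ℓ₀ - ℓ_{j+1} = 0`, whose polynomial is `c y_{j+1} - y₀`.
    have h2 : ∑ i ∈ ({0, j.succ} : Finset (Fin (n + 1))),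
        C ((Fin.cons c fun _ => -1 : Fin (n + 1) → K) i) * ℓ i = 0 := by
      rw [Finset.sum_pair (Fin.succ_ne_zero j).symm]
      simp [hj]
    convert depPoly_mem_depIdeal h2 using 1
    rw [depPoly, Finset.sum_pair (Fin.succ_ne_zero j).symm, Finset.erase_insert, Finset.pair_comm,
      Finset.erase_insert]
    · simp [sub_eq_add_neg]
    · simp
    · simpa using (Fin.succ_ne_zero j).symm
  have h2 : (Ideal.Quotient.mkₐ K (depIdeal ℓ)).comp ((rename Fin.succ).comp σ) =
      Ideal.Quotient.mkₐ K (depIdeal ℓ) := by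
    refine algHom_ext fun i => ?_
    refine Fin.cases ?_ (fun i => ?_) i
    · simp only [AlgHom.comp_apply, σ, aeval_X, Fin.cons_zero, map_mul, rename_C, rename_X]
      rw [← map_mul]
      exact Ideal.Quotient.eq.2 h1
    · simp [σ]
  exact Ideal.Quotient.eq.1 (DFunLike.congr_fun h2 G).symm

theorem aeval_recip_finSuccEquiv_symm (ℓ : Fin (n + 1) → MvPolynomial (Fin k) K)
    (p : Polynomial (MvPolynomial (Fin n) K)) :
    aeval (recip ℓ) ((finSuccEquiv K n).symm p) =
      p.eval₂ (aeval (R := K) (recip fun j => ℓ (Fin.succ j)) : MvPolynomial (Fin n) K →+* _)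
        (algebraMap (MvPolynomial (Fin k) K) (FractionRing (MvPolynomial (Fin k) K)) (ℓ 0))⁻¹ := by
  obtain ⟨G, rfl⟩ := (finSuccEquiv K n).surjective p
  rw [AlgEquiv.symm_apply_apply]
  induction G using MvPolynomial.induction_on with
  | C a => simp [finSuccEquiv_apply]
  | add p q hp hq => rw [map_add, map_add, hp, hq, Polynomial.eval₂_add]
  | mul_X p i hp =>
    rw [map_mul, map_mul, hp, Polynomial.eval₂_mul]
    congr 1
    refine Fin.cases ?_ (fun i => ?_) i
    · simp [finSuccEquiv_X_zero, recip]
    · simp [finSuccEquiv_X_succ, recip]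

theorem finSuccEquiv_symm_C (G : MvPolynomial (Fin n) K) :
    (finSuccEquiv K n).symm (Polynomial.C G) = rename Fin.succ G := by
  rw [AlgEquiv.symm_apply_eq]
  have : ((finSuccEquiv K n).toAlgHom.comp (rename Fin.succ)) =
      (Algebra.ofId (MvPolynomial (Fin n) K) _).restrictScalars K :=
    algHom_ext fun i => by simp [finSuccEquiv_X_succ, Algebra.ofId_apply]
  exact (DFunLike.congr_fun this G).symm

theorem finSuccEquiv_symm_X :
    (finSuccEquiv K n).symm Polynomial.X = X 0 := by
  rw [AlgEquiv.symm_apply_eq, finSuccEquiv_X_zero]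

theorem rename_succ_mem_presIdeal_iff {ℓ : Fin (n + 1) → MvPolynomial (Fin k) K}
    {G : MvPolynomial (Fin n) K} :
    rename Fin.succ G ∈ presIdeal ℓ ↔ G ∈ presIdeal fun i => ℓ (Fin.succ i) := by
  rw [presIdeal, presIdeal, RingHom.mem_ker, RingHom.mem_ker, aeval_rename]
  rfl

/-- Proportional forms must be allowed here: distinct forms can become proportional modulo `ℓ 0`,
and the induction applies to these reduced forms. -/
theorem presIdeal_le_depIdeal {ℓ : Fin n → MvPolynomial (Fin k) K}
    (h1 : ∀ i, (ℓ i).IsHomogeneous 1) (h0 : ∀ i, ℓ i ≠ 0) : presIdeal ℓ ≤ depIdeal ℓ := by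
  induction n with
  | zero =>
    intro G hG
    rw [presIdeal, RingHom.mem_ker, eq_C_of_isEmpty G, aeval_C,
      FaithfulSMul.algebraMap_eq_zero_iff] at hG
    rw [eq_C_of_isEmpty G, hG, C_0]
    exact zero_mem _
  | succ n ih =>
    have hle := depIdeal_le_presIdeal h0
    have hrename : ∀ H : MvPolynomial (Fin n) K, rename Fin.succ H ∈ presIdeal ℓ →
        rename Fin.succ H ∈ depIdeal ℓ := fun H hH =>
      rename_succ_mem_depIdeal
        (ih (fun i => h1 i.succ) (fun i => h0 i.succ) (rename_succ_mem_presIdeal_iff.1 hH))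
    obtain ⟨φ, hφ0, hφ⟩ := exists_projection (h1 0) (h0 0)
    choose s hs using fun j : Fin n => hφ (ℓ j.succ) (h1 j.succ)
    by_cases hpar : ∃ j : Fin n, φ (ℓ j.succ) = 0
    · obtain ⟨j, hj⟩ := hpar
      intro G hG
      obtain ⟨H, hH⟩ := exists_sub_rename_succ_mem (ℓ := ℓ) (j := j) (c := s j)
        (sub_eq_zero.1 ((hs j).symm.trans hj)) G
      exact ((depIdeal ℓ).sub_mem_iff_left (hrename H
        (((presIdeal ℓ).sub_mem_iff_right hG).1 (hle hH)))).1 hH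
    · push Not at hpar
      have hφ1 : ∀ j : Fin n, (φ (ℓ j.succ)).IsHomogeneous 1 := fun j => by
        rw [hs j]
        exact (h1 _).sub (by simpa using (isHomogeneous_C _ (s j)).mul (h1 0))
      have key : ∀ (D : ℕ) (p : Polynomial (MvPolynomial (Fin n) K)), p.natDegree ≤ D →
          (finSuccEquiv K n).symm p ∈ presIdeal ℓ → (finSuccEquiv K n).symm p ∈ depIdeal ℓ := by
        intro D
        induction D with
        | zero =>
          intro p hp hpI
          rw [Polynomial.eq_C_of_natDegree_le_zero hp, finSuccEquiv_symm_C] at hpI ⊢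
          exact hrename _ hpI
        | succ D ihD =>
          intro p hp hpI
          have hcoeff : p.coeff (D + 1) ∈ presIdeal fun j : Fin n => φ (ℓ j.succ) := by
            refine coeff_mem_presIdeal (ℓ := fun j : Fin n => ℓ j.succ) (h0 0) φ hφ0 hpar hp ?_
            rw [← aeval_recip_finSuccEquiv_symm]
            exact hpI
          obtain ⟨H, hH⟩ := exists_X_zero_mul_sub_mem (ℓ := ℓ) hs (ih hφ1 hpar hcoeff)
          -- With `G` the top coefficient, `y₀ G ≡ H` modulo `depIdeal ℓ`, so `G y₀^(D+1)` may be
          -- replaced by `H y₀^D`.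
          set q := p.erase (D + 1) + Polynomial.monomial D H
          have hq : q.natDegree ≤ D := by
            refine Polynomial.natDegree_add_le_of_degree_le ?_ (Polynomial.natDegree_monomial_le _)
            rw [Polynomial.natDegree_le_iff_coeff_eq_zero]
            intro N hN
            rw [Polynomial.coeff_erase]
            split_ifs with hND
            · rfl
            · exact Polynomial.coeff_eq_zero_of_natDegree_lt (by omega)
          have hpq : (finSuccEquiv K n).symm p - (finSuccEquiv K n).symm q ∈ depIdeal ℓ := by
            convert Ideal.mul_mem_left _ (X 0 ^ D) hH using 1
            nth_rewrite 1 [← Polynomial.monomial_add_erase p (D + 1)]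
            rw [map_add, map_add, ← Polynomial.C_mul_X_pow_eq_monomial,
              ← Polynomial.C_mul_X_pow_eq_monomial, map_mul, map_mul, map_pow, map_pow,
              finSuccEquiv_symm_C, finSuccEquiv_symm_C, finSuccEquiv_symm_X]
            ring
          exact ((depIdeal ℓ).sub_mem_iff_left (ihD q hq
            (((presIdeal ℓ).sub_mem_iff_right hpI).1 (hle hpq)))).1 hpq
      intro G hG
      have := key _ (finSuccEquiv K n G) le_rfl
      rw [AlgEquiv.symm_apply_apply] at this
      exact this hG

theorem presIdeal_eq_depIdeal {ℓ : Fin n → MvPolynomial (Fin k) K}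
    (h1 : ∀ i, (ℓ i).IsHomogeneous 1) (h0 : ∀ i, ℓ i ≠ 0) : presIdeal ℓ = depIdeal ℓ :=
  le_antisymm (presIdeal_le_depIdeal h1 h0) (depIdeal_le_presIdeal h0)

end Generation

/-! ### Comparison of `J(𝒜)` with `I(𝒜)`. -/

section SecondOrder

variable {K : Type*} [Field K] {k n : ℕ} {ℓ : Fin n → MvPolynomial (Fin k) K}

theorem aeval_recip_subst (F : MvPolynomial (Pairs n) K) :
    aeval (recip ℓ) (subst K n F) = aeval (recip₂ ℓ) F := by
  have : (aeval (R := K) (recip ℓ)).comp (subst K n) = aeval (recip₂ ℓ) :=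
    algHom_ext fun p => by simp [subst, recip, recip₂, mul_comm]
  exact DFunLike.congr_fun this F

theorem range_subst : (subst K n).range = subringS' K n := by
  rw [subst, ← Algebra.adjoin_range_eq_range_aeval, subringS']

theorem idealJ_le_presIdeal : idealJ ℓ ≤ presIdeal ℓ := by
  rw [idealJ, Ideal.span_le]
  rintro _ ⟨F, hF, rfl⟩
  rw [SetLike.mem_coe, presIdeal, RingHom.mem_ker, aeval_recip_subst]
  exact hF

theorem mem_idealJ_of_mem_subringS' {G : MvPolynomial (Fin n) K} (hS : G ∈ subringS' K n)
    (hG : G ∈ presIdeal ℓ) : G ∈ idealJ ℓ := by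
  rw [← range_subst] at hS
  obtain ⟨F, rfl⟩ := hS
  refine Ideal.subset_span ⟨F, ?_, rfl⟩
  rw [presIdeal₂, RingHom.mem_ker, ← aeval_recip_subst]
  exact hG

theorem idealJ'_eq : idealJ' ℓ = interS' (presIdeal ℓ) := by
  ext G
  exact ⟨fun h => idealJ_le_presIdeal h, fun h => mem_idealJ_of_mem_subringS' G.2 h⟩

/-! ### Parity of monomials and the colon ideal. -/

theorem X_mul_X_mem_subringS' {i j : Fin n} (hij : i ≠ j) :
    (X i * X j : MvPolynomial (Fin n) K) ∈ subringS' K n := by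
  rcases lt_or_gt_of_ne hij with h | h
  · exact Algebra.subset_adjoin ⟨⟨(i, j), h⟩, rfl⟩
  · rw [mul_comm]
    exact Algebra.subset_adjoin ⟨⟨(j, i), h⟩, rfl⟩

theorem prod_X_mem_subringS' {U : Finset (Fin n)} (hU : Even U.card) :
    (∏ u ∈ U, X u : MvPolynomial (Fin n) K) ∈ subringS' K n := by
  induction U using Finset.strongInduction with
  | H U ih =>
    rcases U.eq_empty_or_nonempty with rfl | ⟨i, hi⟩
    · simp
    · have hc : (U.erase i).card + 1 = U.card := Finset.card_erase_add_one hi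
      obtain ⟨j, hj⟩ : (U.erase i).Nonempty := by
        rw [← Finset.card_pos]
        by_contra h
        rw [show U.card = 1 by omega] at hU
        exact absurd hU (by decide)
      have hc' : ((U.erase i).erase j).card + 1 = (U.erase i).card := Finset.card_erase_add_one hj
      rw [← Finset.mul_prod_erase U _ hi, ← Finset.mul_prod_erase _ _ hj, ← mul_assoc]
      refine mul_mem (X_mul_X_mem_subringS' (Finset.ne_of_mem_erase hj).symm) (ih _ ?_ ?_)
      · exact (Finset.erase_subset _ _).trans_ssubset (Finset.erase_ssubset hi)
      · rw [← hc, ← hc', add_assoc] at hU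
        simpa [Nat.even_add] using hU

/-- The index `i` may lie in `U`, and `yᵢ²` is not a generator of `S'`; so `yᵢ` is paired with some
`yⱼ`, `j ≠ i`, leaving an even square-free monomial. -/
theorem X_mul_prod_X_mem_subringS' (i : Fin n) {U : Finset (Fin n)} (hU : Odd U.card)
    (hU2 : 2 ≤ U.card) : (X i * ∏ u ∈ U, X u : MvPolynomial (Fin n) K) ∈ subringS' K n := by
  obtain ⟨j, hj, hji⟩ := Finset.exists_mem_ne hU2 i
  have hc : (U.erase j).card + 1 = U.card := Finset.card_erase_add_one hj
  rw [← Finset.mul_prod_erase U _ hj, ← mul_assoc]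
  refine mul_mem (X_mul_X_mem_subringS' hji.symm) (prod_X_mem_subringS' ?_)
  rw [← hc] at hU
  simpa [Nat.odd_add_one] using hU

/-- If `b ≠ 0`, then `ℓ j` divides `ℓ i`, so coprimality makes a form of degree one a unit. -/
theorem eq_zero_of_dependency_pair (hℓ : IsArrangement ℓ) {i j : Fin n} (hij : i ≠ j) {b c : K}
    (h : C b * ℓ i + C c * ℓ j = 0) : b = 0 := by
  by_contra hb
  have hdvd : ℓ j ∣ ℓ i := by
    refine ⟨C (-(b⁻¹ * c)), ?_⟩
    have h1 : ℓ i = C b⁻¹ * (C b * ℓ i) := by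
      rw [← mul_assoc, ← C_mul, inv_mul_cancel₀ hb, C_1, one_mul]
    rw [h1, eq_neg_of_add_eq_zero_left h, C_neg, C_mul]
    ring
  have hu : IsUnit (ℓ j) := hℓ.isRelPrime i j hij hdvd dvd_rfl
  rw [MvPolynomial.isUnit_iff_totalDegree_of_isReduced,
    (hℓ.isHomogeneous j).totalDegree (hℓ.ne_zero j)] at hu
  exact one_ne_zero hu.2

/-- In an arrangement, dependencies involving at most two forms are trivial. -/
theorem depPoly_eq_zero (hℓ : IsArrangement ℓ) {a : Fin n → K} {T : Finset (Fin n)}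
    (h : ∑ j ∈ T, C (a j) * ℓ j = 0) (hT : T.card ≤ 2) : depPoly a T = 0 := by
  refine Finset.sum_eq_zero fun j hj => ?_
  suffices hz : a j = 0 by rw [hz, C_0, zero_mul]
  rw [← Finset.add_sum_erase T _ hj] at h
  have hc : (T.erase j).card + 1 = T.card := Finset.card_erase_add_one hj
  rcases (T.erase j).eq_empty_or_nonempty with he | ⟨i, hi⟩
  · rw [he, Finset.sum_empty, add_zero] at h
    exact C_eq_zero.1 ((mul_eq_zero.1 h).resolve_right (hℓ.ne_zero j))
  · have he : T.erase j = {i} := by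
      refine (Finset.eq_of_subset_of_card_le (Finset.singleton_subset_iff.2 hi) ?_).symm
      rw [Finset.card_singleton]
      omega
    rw [he, Finset.sum_singleton] at h
    exact eq_zero_of_dependency_pair hℓ (Finset.ne_of_mem_erase hi).symm h

theorem X_mul_depPoly_mem_idealJ (hℓ : IsArrangement ℓ) (i : Fin n) {a : Fin n → K}
    {T : Finset (Fin n)} (h : ∑ j ∈ T, C (a j) * ℓ j = 0) : X i * depPoly a T ∈ idealJ ℓ := by
  by_cases hT : T.card ≤ 2
  · rw [depPoly_eq_zero hℓ h hT, mul_zero]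
    exact zero_mem _
  have hmem : depPoly a T ∈ presIdeal ℓ :=
    depIdeal_le_presIdeal hℓ.ne_zero (depPoly_mem_depIdeal h)
  have hc : ∀ j ∈ T, (T.erase j).card + 1 = T.card := fun j hj => Finset.card_erase_add_one hj
  -- The products over `T.erase j` have `|T| - 1` factors, so only an even `|T|` needs the extra
  -- factor `X i` to reach even degree.
  rcases Nat.even_or_odd T.card with he | ho
  · refine mem_idealJ_of_mem_subringS' ?_ (Ideal.mul_mem_left _ _ hmem)
    rw [depPoly, Finset.mul_sum]
    refine sum_mem fun j hj => ?_
    rw [mul_left_comm]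
    refine mul_mem (Subalgebra.algebraMap_mem _ _) (X_mul_prod_X_mem_subringS' i ?_ ?_)
    · rw [← hc j hj] at he
      simpa [Nat.even_add_one] using he
    · have := hc j hj
      omega
  · refine Ideal.mul_mem_left _ _ (mem_idealJ_of_mem_subringS' ?_ hmem)
    refine sum_mem fun j hj => ?_
    refine mul_mem (Subalgebra.algebraMap_mem _ _) (prod_X_mem_subringS' ?_)
    rw [← hc j hj] at ho
    simpa [Nat.odd_add_one] using ho

theorem X_mul_mem_idealJ (hℓ : IsArrangement ℓ) (i : Fin n) {G : MvPolynomial (Fin n) K}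
    (hG : G ∈ presIdeal ℓ) : X i * G ∈ idealJ ℓ := by
  rw [presIdeal_eq_depIdeal hℓ.isHomogeneous hℓ.ne_zero, depIdeal] at hG
  induction hG using Submodule.span_induction with
  | mem x hx =>
    obtain ⟨a, T, h, rfl⟩ := hx
    exact X_mul_depPoly_mem_idealJ hℓ i h
  | zero => simp
  | add x y _ _ hx hy => rw [mul_add]; exact add_mem hx hy
  | smul c x _ hx =>
    rw [smul_eq_mul, mul_left_comm]
    exact Ideal.mul_mem_left _ _ hx

theorem idealJ_colon_eq (hℓ : IsArrangement ℓ) (hn : 1 ≤ n) :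
    (idealJ ℓ).colon
      (Ideal.span (Set.range (X : Fin n → MvPolynomial (Fin n) K)) :
        Ideal (MvPolynomial (Fin n) K)) = presIdeal ℓ := by
  ext G
  rw [Submodule.mem_colon]
  constructor
  · intro h
    have h1 := idealJ_le_presIdeal (h (X ⟨0, hn⟩) (Ideal.subset_span ⟨_, rfl⟩))
    rw [presIdeal, RingHom.mem_ker, smul_eq_mul, map_mul, aeval_X] at h1
    exact (mul_eq_zero.1 h1).resolve_right
      (inv_ne_zero (algebraMap_form_ne_zero hℓ.ne_zero ⟨0, hn⟩))
  · intro hG P hP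
    suffices h : Ideal.span (Set.range (X : Fin n → MvPolynomial (Fin n) K)) ≤
        Submodule.comap (LinearMap.mulLeft (MvPolynomial (Fin n) K) G) (idealJ ℓ) from h hP
    rw [Ideal.span_le]
    rintro _ ⟨i, rfl⟩
    rw [SetLike.mem_coe, Submodule.mem_comap, LinearMap.mulLeft_apply, mul_comm]
    exact X_mul_mem_idealJ hℓ i hG

/-- The evaluation `yᵢ ↦ 1/ℓᵢ` restricted to `S'`, with values in `OT(2, 𝒜)`. -/
def subringS'.toOT₂ (ℓ : Fin n → MvPolynomial (Fin k) K) : subringS' K n →ₐ[K] OT₂ ℓ :=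
  ((aeval (R := K) (recip ℓ)).comp (subringS' K n).val).codRestrict (OT₂ ℓ) (by
    rintro ⟨G, hG⟩
    rw [← range_subst] at hG
    obtain ⟨F, rfl⟩ := hG
    rw [OT₂, Algebra.adjoin_range_eq_range_aeval]
    exact ⟨F, (aeval_recip_subst F).symm⟩)

theorem subringS'.toOT₂_gen (p : Pairs n) : toOT₂ ℓ (subringS'.gen K p) = OT₂.gen ℓ p := by
  apply Subtype.ext
  simp [toOT₂, subringS'.gen, OT₂.gen, recip, recip₂, mul_comm]

theorem subringS'.toOT₂_surjective : Function.Surjective (toOT₂ ℓ) := by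
  rintro ⟨x, hx⟩
  have hx' := hx
  rw [OT₂, Algebra.adjoin_range_eq_range_aeval] at hx'
  obtain ⟨F, hF⟩ := hx'
  refine ⟨⟨subst K n F, by rw [← range_subst]; exact ⟨F, rfl⟩⟩, Subtype.ext ?_⟩
  exact (aeval_recip_subst F).trans hF

/-- The kernel is visibly `I(𝒜) ∩ S'`; claim 2 identifies it with `J'(𝒜)`. -/
theorem subringS'.ker_toOT₂ : RingHom.ker (toOT₂ ℓ) = idealJ' ℓ := by
  rw [idealJ'_eq]
  ext G
  rw [RingHom.mem_ker, ← Subtype.coe_inj]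
  rfl

theorem exists_algEquiv_quotient_of_surjective {A B : Type*} [CommRing A] [CommRing B]
    [Algebra K A] [Algebra K B] (f : A →ₐ[K] B) (hf : Function.Surjective f) {I : Ideal A}
    (hI : RingHom.ker f = I) : ∃ e : B ≃ₐ[K] (A ⧸ I), ∀ x, e (f x) = Ideal.Quotient.mk I x := by
  subst hI
  refine ⟨(Ideal.quotientKerAlgEquivOfSurjective hf).symm, fun x => ?_⟩
  rw [AlgEquiv.symm_apply_eq]
  rfl

theorem exists_algEquiv_quotient (ℓ : Fin n → MvPolynomial (Fin k) K) :
    ∃ e : OT₂ ℓ ≃ₐ[K] (subringS' K n ⧸ idealJ' ℓ), ∀ p : Pairs n,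
      e (OT₂.gen ℓ p) = Ideal.Quotient.mk (idealJ' ℓ) (subringS'.gen K p) := by
  obtain ⟨e, he⟩ := exists_algEquiv_quotient_of_surjective (subringS'.toOT₂ ℓ)
    subringS'.toOT₂_surjective subringS'.ker_toOT₂
  refine ⟨e, fun p => ?_⟩
  rw [← subringS'.toOT₂_gen]
  exact he _

end SecondOrder

end

end OrlikTerao

theorem proposition3p4 {K : Type*} [Field K] [CharZero K] {k n : ℕ} (hn : 1 ≤ n)
    (ℓ : Fin n → MvPolynomial (Fin k) K) (hℓ : OrlikTerao.IsArrangement ℓ) :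
    (OrlikTerao.idealJ ℓ).colon
        (Ideal.span (Set.range (MvPolynomial.X : Fin n → MvPolynomial (Fin n) K)) :
          Ideal (MvPolynomial (Fin n) K)) = OrlikTerao.presIdeal ℓ ∧
    OrlikTerao.idealJ' ℓ = OrlikTerao.interS' (OrlikTerao.presIdeal ℓ) ∧
    ∃ e : OrlikTerao.OT₂ ℓ ≃ₐ[K] (OrlikTerao.subringS' K n ⧸ OrlikTerao.idealJ' ℓ),
      ∀ p : OrlikTerao.Pairs n, e (OrlikTerao.OT₂.gen ℓ p) =
        Ideal.Quotient.mk (OrlikTerao.idealJ' ℓ) (OrlikTerao.subringS'.gen K p) :=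
  ⟨OrlikTerao.idealJ_colon_eq hℓ hn, OrlikTerao.idealJ'_eq, OrlikTerao.exists_algEquiv_quotient ℓ⟩
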